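/- **Stanley's positivity theorem.** Let $P \subset \mathbb{R}^N$ be a nonempty rational polytope, i.e. a bounded set that is the intersection of finitely many half-spaces of the form $a_1x_1+\dots+a_Nx_N \le b$ with $a_1,\dots,a_N,b \in \mathbb{Z}$. Let $d = \dim P$ be the dimension of the affine span of $P$, and let $p \ge 1$ be an integer such that $pP$ is integral, i.e. all vertices of $pP$ lie in $\mathbb{Z}^N$. For $n \ge 1$ put $L_P(n) = \#(nP \cap \mathbb{Z}^N)$. Then there are integers $a_0, a_1, \dots, a_{(d+1)p-1}$, necessarily unique, such that $$1 + \sum_{n\ge 1} L_P(n)\,t^n \;=\; \frac{a_{(d+1)p-1}\,t^{(d+1)p-1} + a_{(d+1)p-2}\,t^{(d+1)p-2} + \dots + a_0}{(1-t^p)^{d+1}}$$ as formal power series in $t$, and these coefficients satisfy $a_0, a_1, \dots, a_{(d+1)p-1} \ge 0$. -/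

import Mathlib

open scoped Pointwise

namespace Ehrhart

/-- A rational polyhedron in `ℝ^N`: the intersection of finitely many half-spaces
`a₁ x₁ + ⋯ + a_N x_N ≤ b` with integers `a₁, …, a_N, b`. -/
def IsRationalPolyhedron {N : ℕ} (P : Set (Fin N → ℝ)) : Prop :=
  ∃ (m : ℕ) (a : Fin m → Fin N → ℤ) (b : Fin m → ℤ),
    P = ⋂ k : Fin m, {x : Fin N → ℝ | ∑ j, (a k j : ℝ) * x j ≤ (b k : ℝ)}

/-- A rational polytope: a bounded rational polyhedron. -/
def IsRationalPolytope {N : ℕ} (P : Set (Fin N → ℝ)) : Prop :=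
  IsRationalPolyhedron P ∧ Bornology.IsBounded P

/-- The integer lattice `ℤ^N` inside `ℝ^N`. -/
def integerPoints (N : ℕ) : Set (Fin N → ℝ) :=
  Set.range fun (z : Fin N → ℤ) (j : Fin N) => (z j : ℝ)

/-- A polytope is integral if all its vertices (extreme points) lie in `ℤ^N`. -/
def HasIntegralVertices {N : ℕ} (P : Set (Fin N → ℝ)) : Prop :=
  Set.extremePoints ℝ P ⊆ integerPoints N

/-- The dimension of a nonempty polytope: the dimension of its affine span. -/
noncomputable def polytopeDim {N : ℕ} (P : Set (Fin N → ℝ)) : ℕ :=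
  Module.finrank ℝ (affineSpan ℝ P).direction

/-- The lattice point enumerator `L_P(n) = #(nP ∩ ℤ^N)` (a finite set when `P` is bounded). -/
noncomputable def latticeCount {N : ℕ} (P : Set (Fin N → ℝ)) (n : ℕ) : ℕ :=
  (((n : ℝ) • P) ∩ integerPoints N).ncard

/-- The Ehrhart series `1 + ∑_{n ≥ 1} L_P(n) tⁿ`, as a formal power series. -/
noncomputable def ehrhartSeries {N : ℕ} (P : Set (Fin N → ℝ)) : PowerSeries ℤ :=
  PowerSeries.mk fun n => if n = 0 then 1 else (latticeCount P n : ℤ)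

/-- `a₀, …, a_{(d+1)p-1}` are the numerator coefficients of the Ehrhart series of `P` over the
denominator `(1 - t^p)^(d+1)`. The denominator has constant term `1` for `p ≥ 1`, hence is a unit
of `ℤ⟦t⟧`, and the fraction identity is stated with the denominator cleared. -/
def IsEhrhartNumerator {N : ℕ} (P : Set (Fin N → ℝ)) (d p : ℕ)
    (a : Fin ((d + 1) * p) → ℤ) : Prop :=
  ehrhartSeries P * (1 - (PowerSeries.X : PowerSeries ℤ) ^ p) ^ (d + 1) =
    ∑ i, PowerSeries.C (a i) * (PowerSeries.X : PowerSeries ℤ) ^ (i : ℕ)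

end Ehrhart

/-! Lift the vertices `v` of `pP` to `(v, p)` and take the cone they generate in their linear span,
of dimension `d + 1`. Its points of height `n` with integral first component are exactly the lattice
points of `nP`, so the Ehrhart series counts lattice points of a cone by height.

Generic costs `ω` on the generators give a regular triangulation of the cone without new rays: its
cells are the dual feasible bases of a linear program (`exists_isDualFeasible`,
`eq_of_isDualFeasible`). Pushing every point slightly along a generic `ξ` in the cone makes the
cells half-open and disjoint, so their series add without inclusion-exclusion
(`existsUnique_mem_halfOpenCone`).

In one half-open cell, each of the `d + 1` factors `1 - X ^ p` removes the translate of the points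
by one generator. What remains is the series of a half-open box, whose coefficients are
cardinalities, hence nonnegative (`gradedSeries_partialBox`). Box points have height below `(d + 1)
* p` (`height_lt_of_mem_partialBox`), which bounds the degree. -/

namespace Ehrhart

open Finset

/-! ### Generic vectors and support reduction -/

section Generic

/-- Finitely many nonzero linear forms are simultaneously nonzero at some positive vector. -/
theorem exists_pos_forall_sum_mul_ne_zero {ι κ : Type*} [Fintype ι] [Finite κ]
    (v : κ → ι → ℝ) (hv : ∀ k, v k ≠ 0) :
    ∃ g : ι → ℝ, (∀ i, 0 < g i) ∧ ∀ k, ∑ i, g i * v k i ≠ 0 := by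
  classical
  let e := Fintype.equivFin ι
  -- Along the moment curve `t ↦ (t ^ e i)` each form becomes a nonzero polynomial in `t`, so only
  -- finitely many `t` are bad.
  let q : κ → Polynomial ℝ := fun k => ∑ i, Polynomial.monomial (e i : ℕ) (v k i)
  have hq : ∀ k, q k ≠ 0 := by
    intro k h0
    apply hv k
    funext i
    have := congrArg (fun r => Polynomial.coeff r (e i : ℕ)) h0
    simpa [q, Polynomial.finsetSum_coeff, Polynomial.coeff_monomial, Fin.val_inj] using this
  have hfin : (⋃ k, {t : ℝ | (q k).IsRoot t}).Finite :=
    Set.finite_iUnion fun k => Polynomial.finite_setOfPred_isRoot (hq k)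
  obtain ⟨t, ht, hnot⟩ := (Set.Ioi_infinite (0 : ℝ)).exists_notMem_finite hfin
  refine ⟨fun i => t ^ (e i : ℕ), fun i => pow_pos ht _, fun k h => hnot ?_⟩
  refine Set.mem_iUnion.2 ⟨k, ?_⟩
  simp only [Set.mem_ofPred_eq, Polynomial.IsRoot.def, q, Polynomial.eval_finsetSum,
    Polynomial.eval_monomial]
  rw [← h]
  exact Finset.sum_congr rfl fun i _ => mul_comm _ _

/-- Moving from a nonnegative vector along a nonzero direction within its support, one can reach
a nonnegative vector of strictly smaller support. -/
theorem exists_add_smul_nonneg_support_lt {ι : Type*} [Fintype ι] {a c : ι → ℝ}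
    (ha : ∀ i, 0 ≤ a i) (hc : c ≠ 0) (hac : ∀ i, a i = 0 → c i = 0) :
    ∃ t : ℝ, (∀ i, 0 ≤ a i + t * c i) ∧
      #{i | a i + t * c i ≠ 0} < #{i | a i ≠ 0} := by
  classical
  wlog hneg : ∃ i, c i < 0 generalizing c
  · push Not at hneg
    obtain ⟨i, hi⟩ := Function.ne_iff.1 hc
    obtain ⟨t, h1, h2⟩ := this (c := -c) (neg_ne_zero.2 hc) (fun i hi => by simp [hac i hi])
      ⟨i, by simpa using lt_of_le_of_ne (hneg i) (Ne.symm hi)⟩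
    refine ⟨-t, by simpa using h1, by simpa using h2⟩
  obtain ⟨i₀, hi₀⟩ := hneg
  -- Ratio test of the simplex method: `k` is a decreasing coordinate that reaches zero first, and
  -- it leaves the support.
  obtain ⟨k, hk, hmin⟩ := Finset.exists_min_image ({i | c i < 0} : Finset ι)
    (fun i => a i / (-c i)) ⟨i₀, by simpa using hi₀⟩
  simp only [Finset.mem_filter, Finset.mem_univ, true_and] at hk hmin
  have ht : 0 ≤ a k / (-c k) := div_nonneg (ha k) (by linarith)
  refine ⟨a k / (-c k), fun i => ?_, ?_⟩
  · rcases lt_or_ge (c i) 0 with h | h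
    · have := hmin i h
      rw [le_div_iff₀ (by linarith)] at this
      linarith
    · have := mul_nonneg ht h
      linarith [ha i]
  · refine Finset.card_lt_card ((Finset.ssubset_iff_of_subset ?_).2 ⟨k, ?_, ?_⟩)
    · intro i
      simp only [Finset.mem_filter, Finset.mem_univ, true_and]
      intro h h0
      exact h (by rw [h0, hac i h0]; simp)
    · simp only [Finset.mem_filter, Finset.mem_univ, true_and]
      exact fun h0 => hk.ne (hac k h0)
    · simp only [Finset.mem_filter, Finset.mem_univ, true_and, not_not]
      field_simp [hk.ne]
      ring

end Generic

/-! ### Bases chosen among the generators -/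

variable {ι E : Type*} [Fintype ι] [AddCommGroup E] [Module ℝ E]

/-- A basis of `E` extracted from the family `w`, with its coordinates extended by zero to the
whole index type. -/
structure CoordSystem (w : ι → E) where
  support : Finset ι
  coord : E →ₗ[ℝ] ι → ℝ
  sum_coord : ∀ x, ∑ i, coord x i • w i = x
  coord_eq_zero : ∀ x, ∀ i ∉ support, coord x i = 0
  coord_sum : ∀ a : ι → ℝ, (∀ i ∉ support, a i = 0) → coord (∑ i, a i • w i) = a
  card_support : #support = Module.finrank ℝ E

namespace CoordSystem

variable {w : ι → E}

/-- This makes the set of bases finite and reduces equality of cells to equality of supports. -/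
theorem support_injective : Function.Injective (support : CoordSystem w → Finset ι) := by
  intro b b' h
  have : b.coord = b'.coord := by
    ext1 x
    have := b.coord_sum (b'.coord x) (fun i hi => b'.coord_eq_zero x i (h ▸ hi))
    rwa [b'.sum_coord] at this
  cases b; cases b'; simp_all

instance : Finite (CoordSystem w) := Finite.of_injective _ support_injective

theorem coord_apply_self (b : CoordSystem w) {i : ι} (hi : i ∈ b.support) [DecidableEq ι] :
    b.coord (w i) = Pi.single i 1 := by
  have := b.coord_sum (Pi.single i 1) (fun j hj => by
    rw [Pi.single_eq_of_ne]; rintro rfl; exact hj hi)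
  simpa [Pi.single_apply] using this

/-- A linearly independent subfamily of a spanning family extends to a coordinate system. -/
theorem exists_of_linearIndepOn {s : Set ι} (hs : LinearIndepOn ℝ w s)
    (hw : Submodule.span ℝ (Set.range w) = ⊤) :
    ∃ b : CoordSystem w, s ⊆ b.support := by
  classical
  obtain ⟨t, -, hst, hts, ht⟩ := exists_linearIndepOn_extension hs (Set.subset_univ s)
  have hspan : ⊤ ≤ Submodule.span ℝ (Set.range fun i : t => w i) := by
    rw [← hw, Submodule.span_le, ← Set.image_univ]
    simpa [Set.image_eq_range] using hts
  let e := Module.Basis.mk (v := fun i : t => w i) ht hspan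
  have he : ∀ i, e i = w i := fun i => Module.Basis.mk_apply ht hspan i
  let c : E →ₗ[ℝ] ι → ℝ := LinearMap.pi fun i => if h : i ∈ t then e.coord ⟨i, h⟩ else 0
  have hc0 : ∀ x, ∀ i ∉ t, c x i = 0 := fun x i hi => by simp [c, hi]
  have hct : ∀ x, ∀ i : t, c x i = e.repr x i := fun x i => by simp [c]
  have key : ∀ a : ι → ℝ, (∀ i ∉ t, a i = 0) → ∑ i, a i • w i = ∑ i : t, a i • w i := by
    intro a ha
    rw [← Finset.sum_subset (s₁ := t.toFinset) (Finset.subset_univ _)]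
    · exact (Finset.sum_subtype t.toFinset (by simp) (fun i => a i • w i))
    · intro i _ hi
      rw [ha i (by simpa using hi), zero_smul]
  refine ⟨⟨t.toFinset, c, ?_, ?_, ?_, ?_⟩, by simpa using hst⟩
  · intro x
    rw [key _ (hc0 x)]
    simp_rw [hct]
    simpa only [he] using e.sum_repr x
  · simpa using hc0
  · intro a ha
    simp only [Set.mem_toFinset] at ha
    rw [key a ha]
    funext i
    by_cases hi : i ∈ t
    · have h1 : ∑ i : t, a i • w i = ∑ i : t, a i • e i := by simp only [he]
      rw [hct _ ⟨i, hi⟩, h1, e.repr_sum_self (fun i : t => a i)]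
    · rw [hc0 _ i hi, ha i hi]
  · rw [Module.finrank_eq_card_basis e, Set.toFinset_card]

end CoordSystem

end Ehrhart

/-! ### Regular triangulation through linear programming duality -/

namespace Ehrhart

open Finset

variable {ι E : Type*} [Fintype ι] [AddCommGroup E] [Module ℝ E]

/-- The convex cone generated by a finite family of vectors. -/
def coneOf (w : ι → E) : Set E := {x | ∃ a : ι → ℝ, (∀ i, 0 ≤ a i) ∧ ∑ i, a i • w i = x}

namespace CoordSystem

variable {w : ι → E}

/-- The cost of `x` when it is written in terms of the basis `b`. -/
def price (b : CoordSystem w) (ω : ι → ℝ) (x : E) : ℝ := ∑ i, b.coord x i * ω i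

theorem price_sum (b : CoordSystem w) (ω a : ι → ℝ) :
    b.price ω (∑ i, a i • w i) = ∑ i, a i * b.price ω (w i) := by
  simp only [price, map_sum, map_smul, Finset.sum_apply, Pi.smul_apply, smul_eq_mul,
    Finset.sum_mul, Finset.mul_sum, mul_assoc]
  exact Finset.sum_comm

theorem price_apply_self (b : CoordSystem w) (ω : ι → ℝ) {i : ι} (hi : i ∈ b.support) :
    b.price ω (w i) = ω i := by
  classical
  simp [price, b.coord_apply_self hi, Pi.single_apply]

/-- Dual feasibility: the simplicial cone of `b` belongs to the regular triangulation
defined by the heights `ω`. -/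
def IsDualFeasible (b : CoordSystem w) (ω : ι → ℝ) : Prop :=
  ∀ i ∉ b.support, b.price ω (w i) < ω i

theorem IsDualFeasible.le {b : CoordSystem w} {ω : ι → ℝ} (h : b.IsDualFeasible ω) (i : ι) :
    b.price ω (w i) ≤ ω i := by
  by_cases hi : i ∈ b.support
  · exact (b.price_apply_self ω hi).le
  · exact (h i hi).le

/-- Weak duality: expand `y` in `b'` with nonnegative coefficients and bound the price of each
generator by its cost. -/
theorem IsDualFeasible.price_le {b b' : CoordSystem w} {ω : ι → ℝ} (h : b.IsDualFeasible ω)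
    {y : E} (hy : ∀ i, 0 ≤ b'.coord y i) : b.price ω y ≤ b'.price ω y := by
  conv_lhs => rw [← b'.sum_coord y, price_sum]
  exact Finset.sum_le_sum fun i _ => mul_le_mul_of_nonneg_left (h.le i) (hy i)

/-- Complementary slackness: a generator used by `b'` but absent from `b` would make the weak
duality inequality strict. -/
theorem IsDualFeasible.support_subset {b b' : CoordSystem w} {ω : ι → ℝ}
    (h : b.IsDualFeasible ω) {y : E} (hy : ∀ i ∈ b'.support, 0 < b'.coord y i)
    (hp : b'.price ω y ≤ b.price ω y) : b'.support ⊆ b.support := by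
  intro i hi
  by_contra hib
  refine hp.not_gt ?_
  conv_lhs => rw [← b'.sum_coord y, price_sum]
  refine Finset.sum_lt_sum (fun j _ => mul_le_mul_of_nonneg_left (h.le j) ?_)
    ⟨i, Finset.mem_univ _, mul_lt_mul_of_pos_left (h i hib) (hy i hi)⟩
  by_cases hj : j ∈ b'.support
  · exact (hy j hj).le
  · exact (b'.coord_eq_zero y j hj).ge

theorem nonneg_of_pos {b : CoordSystem w} {y : E} (hy : ∀ i ∈ b.support, 0 < b.coord y i)
    (i : ι) : 0 ≤ b.coord y i := by
  by_cases hi : i ∈ b.support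
  · exact (hy i hi).le
  · exact (b.coord_eq_zero y i hi).ge

/-- Open simplicial cones of the triangulation are disjoint. -/
theorem eq_of_isDualFeasible {b b' : CoordSystem w} {ω : ι → ℝ} (h : b.IsDualFeasible ω)
    (h' : b'.IsDualFeasible ω) {y : E} (hy : ∀ i ∈ b.support, 0 < b.coord y i)
    (hy' : ∀ i ∈ b'.support, 0 < b'.coord y i) : b = b' :=
  support_injective <| Finset.Subset.antisymm
    (h'.support_subset hy (h.price_le (nonneg_of_pos hy')))
    (h.support_subset hy' (h'.price_le (nonneg_of_pos hy)))

/-- A nonnegative combination of minimal cost is attained on a linearly independent subfamily. -/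
theorem exists_minimal_cost {h : E →ₗ[ℝ] ℝ} {p : ℝ} (hp : 0 < p) (hh : ∀ i, h (w i) = p)
    (ω : ι → ℝ) {y : E} (hy : y ∈ coneOf w) :
    ∃ a : ι → ℝ, (∀ i, 0 ≤ a i) ∧ ∑ i, a i • w i = y ∧
      (∀ a' : ι → ℝ, (∀ i, 0 ≤ a' i) → ∑ i, a' i • w i = y →
        ∑ i, a i * ω i ≤ ∑ i, a' i * ω i) ∧
      LinearIndepOn ℝ w {i | a i ≠ 0} := by
  classical
  let K : Set (ι → ℝ) := {a | (∀ i, 0 ≤ a i) ∧ ∑ i, a i • w i = y}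
  -- All generators have the same height, so the height of `y` fixes the total weight; this bounds
  -- the feasible set `K`.
  have hsum : ∀ a ∈ K, ∑ i, a i = h y / p := by
    rintro a ⟨-, rfl⟩
    simp [hh, ← Finset.sum_mul, hp.ne']
  have hKc : IsCompact K := by
    refine Metric.isCompact_of_isClosed_isBounded ?_ ?_
    · obtain ⟨a₀, -, ha₀⟩ := hy
      let T : (ι → ℝ) →ₗ[ℝ] E := Fintype.linearCombination ℝ w
      -- `E` carries no topology, so closedness is read off in `ι → ℝ` from a translate of the
      -- kernel.
      have hK : K = {a | ∀ i, 0 ≤ a i} ∩ (fun a => a - a₀) ⁻¹' (LinearMap.ker T : Set (ι → ℝ)) := by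
        ext a
        simp [K, T, Fintype.linearCombination_apply, sub_smul, Finset.sum_sub_distrib, ha₀,
          sub_eq_zero]
      rw [hK]
      refine IsClosed.inter ?_ ?_
      · simp only [Set.ofPred_forall]
        exact isClosed_iInter fun i => isClosed_le continuous_const (continuous_apply i)
      · exact (Submodule.closed_of_finiteDimensional _).preimage (by fun_prop)
    · refine (Metric.isBounded_Icc (0 : ι → ℝ) (fun _ => h y / p)).subset ?_
      rintro a ha
      refine ⟨ha.1, fun i => ?_⟩
      rw [← hsum a ha]
      exact Finset.single_le_sum (fun j _ => ha.1 j) (Finset.mem_univ i)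
  obtain ⟨a₀, ha₀, hmin₀⟩ := hKc.exists_isMinOn (f := fun a => ∑ i, a i * ω i) hy
    (by fun_prop)
  -- Among the optimal solutions one of smallest support is taken; a linear relation `c` on its
  -- support will shrink it further.
  have hex : ∃ n : ℕ, ∃ a ∈ K, ∑ i, a i * ω i = ∑ i, a₀ i * ω i ∧ #{i | a i ≠ 0} = n :=
    ⟨_, a₀, ha₀, rfl, rfl⟩
  obtain ⟨a, haK, hcost, hcard⟩ := Nat.find_spec hex
  have hmin : ∀ a' ∈ K, ∑ i, a i * ω i ≤ ∑ i, a' i * ω i := fun a' ha' => hcost ▸ hmin₀ ha'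
  refine ⟨a, haK.1, haK.2, fun a' h1 h2 => hmin a' ⟨h1, h2⟩, ?_⟩
  by_contra hdep
  obtain ⟨c, hcs, hc0, hcne⟩ : ∃ c : ι → ℝ, (∀ i, a i = 0 → c i = 0) ∧
      ∑ i, c i • w i = 0 ∧ c ≠ 0 := by
    have hS : {i | a i ≠ 0} = (({i | a i ≠ 0} : Finset ι) : Set ι) := by ext; simp
    rw [hS, linearIndepOn_finset_iff] at hdep
    push Not at hdep
    obtain ⟨g, hg, i, hi, hgi⟩ := hdep
    refine ⟨fun i => if a i = 0 then 0 else g i, fun i hi => if_pos hi, ?_, ?_⟩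
    · rw [← hg, Finset.sum_filter]
      refine Finset.sum_congr rfl fun i _ => ?_
      by_cases h0 : a i = 0 <;> simp [h0]
    · intro h0
      have := congrFun h0 i
      simp only [Finset.mem_filter, Finset.mem_univ, true_and] at hi
      rw [if_neg hi] at this
      exact hgi this
  have hmem : ∀ t : ℝ, (∀ i, 0 ≤ a i + t * c i) → (fun i => a i + t * c i) ∈ K := by
    refine fun t ht => ⟨ht, ?_⟩
    simp only [add_smul, mul_smul, Finset.sum_add_distrib, ← Finset.smul_sum, hc0, smul_zero,
      add_zero, haK.2]
  have hcostt : ∀ t : ℝ, ∑ i, (a i + t * c i) * ω i =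
      ∑ i, a i * ω i + t * ∑ i, c i * ω i := by
    intro t
    simp only [add_mul, Finset.sum_add_distrib, Finset.mul_sum, mul_assoc]
  -- Small moves along both `c` and `-c` stay feasible, so optimality forces the cost to be constant
  -- along `c`.
  have hcω : ∑ i, c i * ω i = 0 := by
    have hsmall : ∃ δ > 0, ∀ i, 0 ≤ a i + δ * c i ∧ 0 ≤ a i + (-δ) * c i := by
      have hev : ∀ᶠ δ : ℝ in nhdsWithin 0 (Set.Ioi 0), ∀ i, 0 ≤ a i + δ * c i ∧
          0 ≤ a i + (-δ) * c i := by
        refine Filter.eventually_all.2 fun i => ?_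
        by_cases hi : a i = 0
        · simp [hi, hcs i hi]
        · have hpos : 0 < a i := lt_of_le_of_ne (haK.1 i) (Ne.symm hi)
          refine Filter.Eventually.filter_mono nhdsWithin_le_nhds (Filter.Eventually.and ?_ ?_)
          · have : Filter.Tendsto (fun δ : ℝ => a i + δ * c i) (nhds 0) (nhds (a i + 0 * c i)) :=
              Continuous.tendsto (by fun_prop) 0
            exact (this.eventually (lt_mem_nhds (by simpa using hpos))).mono fun _ => le_of_lt
          · have : Filter.Tendsto (fun δ : ℝ => a i + -δ * c i) (nhds 0)
                (nhds (a i + -0 * c i)) := Continuous.tendsto (by fun_prop) 0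
            exact (this.eventually (lt_mem_nhds (by simpa using hpos))).mono fun _ => le_of_lt
      obtain ⟨δ, h1, h2⟩ := (hev.and self_mem_nhdsWithin).exists
      exact ⟨δ, h2, h1⟩
    obtain ⟨δ, hδ, hs⟩ := hsmall
    have h1 := hmin _ (hmem δ fun i => (hs i).1)
    have h2 := hmin _ (hmem (-δ) fun i => (hs i).2)
    rw [hcostt] at h1 h2
    nlinarith
  obtain ⟨t, ht, hlt⟩ := exists_add_smul_nonneg_support_lt haK.1 hcne hcs
  refine Nat.find_min hex (hcard ▸ hlt) ⟨_, hmem t ht, ?_, rfl⟩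
  rw [hcostt, hcω, mul_zero, add_zero, hcost]

/-- Every generic point of the cone lies in an open simplicial cone of the triangulation. -/
theorem exists_isDualFeasible {h : E →ₗ[ℝ] ℝ} {p : ℝ} (hp : 0 < p) (hh : ∀ i, h (w i) = p)
    (hw : Submodule.span ℝ (Set.range w) = ⊤) {ω : ι → ℝ}
    (hω : ∀ b : CoordSystem w, ∀ i ∉ b.support, b.price ω (w i) ≠ ω i)
    {y : E} (hy : y ∈ coneOf w) (hyg : ∀ b : CoordSystem w, ∀ i ∈ b.support, b.coord y i ≠ 0) :
    ∃ b : CoordSystem w, b.IsDualFeasible ω ∧ ∀ i ∈ b.support, 0 < b.coord y i := by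
  classical
  obtain ⟨a, ha, hay, hmin, hind⟩ := exists_minimal_cost hp hh ω hy
  obtain ⟨b, hb⟩ := exists_of_linearIndepOn hind hw
  have hba : b.coord y = a := by
    rw [← hay]
    refine b.coord_sum a fun i hi => ?_
    by_contra h0
    exact hi (hb h0)
  have hpos : ∀ i ∈ b.support, 0 < a i := fun i hi =>
    lt_of_le_of_ne (ha i) (hba ▸ hyg b i hi).symm
  refine ⟨b, fun v hv => lt_of_le_of_ne ?_ (hω b v hv), hba ▸ hpos⟩
  -- Reduced cost test: replace `δ` times the expansion of `w v` in `b` by `δ • w v`. Genericity of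
  -- `y` makes `a` positive on the support, which leaves room for `δ > 0`.
  obtain ⟨δ, hδ, hs⟩ : ∃ δ : ℝ, 0 < δ ∧ ∀ i ∈ b.support, 0 ≤ a i - δ * b.coord (w v) i := by
    have hev : ∀ᶠ δ : ℝ in nhdsWithin 0 (Set.Ioi 0),
        ∀ i ∈ b.support, 0 ≤ a i - δ * b.coord (w v) i := by
      rw [Filter.eventually_all_finset]
      intro i hi
      refine Filter.Eventually.filter_mono nhdsWithin_le_nhds ?_
      have : Filter.Tendsto (fun δ : ℝ => a i - δ * b.coord (w v) i) (nhds 0)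
          (nhds (a i - 0 * b.coord (w v) i)) := Continuous.tendsto (by fun_prop) 0
      exact (this.eventually (lt_mem_nhds (by simpa using hpos i hi))).mono fun _ => le_of_lt
    obtain ⟨δ, h1, h2⟩ := (hev.and self_mem_nhdsWithin).exists
    exact ⟨δ, h2, h1⟩
  have key := hmin (fun i => a i - δ * b.coord (w v) i + δ * (Pi.single v 1 : ι → ℝ) i)
    (fun i => ?_) ?_
  · simp only [add_mul, sub_mul, Finset.sum_add_distrib, Finset.sum_sub_distrib, mul_assoc,
      ← Finset.mul_sum] at key
    simp only [Pi.single_apply, ite_mul, one_mul, zero_mul, Finset.sum_ite_eq',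
      Finset.mem_univ, if_true] at key
    have : δ * b.price ω (w v) ≤ δ * ω v := by rw [price]; linarith
    exact le_of_mul_le_mul_left this hδ
  · by_cases hi : i ∈ b.support
    · have : 0 ≤ δ * (Pi.single v 1 : ι → ℝ) i :=
        mul_nonneg hδ.le (by rw [Pi.single_apply]; split_ifs <;> norm_num)
      linarith [hs i hi]
    · rw [b.coord_eq_zero _ i hi, mul_zero, sub_zero]
      exact add_nonneg (ha i)
        (mul_nonneg hδ.le (by rw [Pi.single_apply]; split_ifs <;> norm_num))
  · simp only [add_smul, sub_smul, mul_smul, Finset.sum_add_distrib, Finset.sum_sub_distrib,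
      ← Finset.smul_sum, hay, b.sum_coord]
    simp [Pi.single_apply]

end CoordSystem

end Ehrhart

/-! ### Generating functions by height -/

namespace Ehrhart

open Finset

section GradedSeries

variable {E : Type*} [AddCommGroup E] [Module ℝ E]

/-- The generating function of the points of `S` with respect to their height `h`. -/
noncomputable def gradedSeries (h : E →ₗ[ℝ] ℝ) (S : Set E) : PowerSeries ℤ :=
  PowerSeries.mk fun n => ({x ∈ S | h x = n}.ncard : ℤ)

/-- Translation by `v` carries the points of height `n - p` bijectively onto the points `x` of
height `n` with `x - v ∈ S`, so the subtraction leaves the others. -/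
theorem gradedSeries_mul_one_sub_X_pow {h : E →ₗ[ℝ] ℝ} {S : Set E} {v : E} {p : ℕ}
    (hv : h v = p) (hS : ∀ x ∈ S, x + v ∈ S) (hnonneg : ∀ x ∈ S, 0 ≤ h x)
    (hfin : ∀ n : ℕ, {x ∈ S | h x = n}.Finite) :
    gradedSeries h S * (1 - PowerSeries.X ^ p) = gradedSeries h {x ∈ S | x - v ∉ S} := by
  ext n
  rw [mul_sub, mul_one, map_sub, PowerSeries.coeff_mul_X_pow']
  simp only [gradedSeries, PowerSeries.coeff_mk]
  rw [sub_eq_iff_eq_add]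
  have hsplit : {x ∈ S | h x = n} =
      {x ∈ {x ∈ S | x - v ∉ S} | h x = n} ∪ {x ∈ S | x - v ∈ S ∧ h x = n} := by
    ext x
    simp only [Set.mem_union, Set.mem_ofPred_eq]
    tauto
  have hcard : {x ∈ S | h x = n}.ncard =
      {x ∈ {x ∈ S | x - v ∉ S} | h x = n}.ncard + {x ∈ S | x - v ∈ S ∧ h x = n}.ncard := by
    rw [hsplit]
    exact Set.ncard_union_eq (Set.disjoint_left.2 fun x hx hx' => hx.1.2 hx'.2.1)
      ((hfin n).subset fun x hx => ⟨hx.1.1, hx.2⟩) ((hfin n).subset fun x hx => ⟨hx.1, hx.2.2⟩)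
  rw [hcard]
  push_cast
  congr 1
  split_ifs with hpn
  · have himg : {x ∈ S | x - v ∈ S ∧ h x = n} = (· + v) '' {x ∈ S | h x = (n - p : ℕ)} := by
      ext x
      simp only [Set.mem_image, Set.mem_ofPred_eq]
      constructor
      · rintro ⟨-, h1, h2⟩
        exact ⟨x - v, ⟨h1, by rw [map_sub, h2, hv, Nat.cast_sub hpn]⟩, by simp⟩
      · rintro ⟨y, ⟨h1, h2⟩, rfl⟩
        exact ⟨hS y h1, by simpa using h1, by rw [map_add, h2, hv, Nat.cast_sub hpn]; ring⟩
    rw [himg, Set.ncard_image_of_injective _ (add_left_injective v)]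
  · have hemp : {x ∈ S | x - v ∈ S ∧ h x = n} = ∅ := by
      refine Set.eq_empty_of_forall_notMem ?_
      rintro x ⟨-, h1, h2⟩
      have h3 := hnonneg _ h1
      rw [map_sub, h2, hv, sub_nonneg] at h3
      exact hpn (by exact_mod_cast h3)
    rw [hemp]
    simp

theorem gradedSeries_eq_sum {κ : Type*} [Fintype κ] {h : E →ₗ[ℝ] ℝ} {S : Set E}
    (T : κ → Set E) (hTS : ∀ k, T k ⊆ S) (hex : ∀ x ∈ S, ∃! k, x ∈ T k)
    (hfin : ∀ n : ℕ, {x ∈ S | h x = n}.Finite) :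
    gradedSeries h S = ∑ k, gradedSeries h (T k) := by
  ext n
  simp only [gradedSeries, map_sum, PowerSeries.coeff_mk]
  have hU : {x ∈ S | h x = n} = ⋃ k, {x ∈ T k | h x = n} := by
    ext x
    simp only [Set.mem_iUnion, Set.mem_ofPred_eq]
    constructor
    · rintro ⟨h1, h2⟩
      obtain ⟨k, hk, -⟩ := hex x h1
      exact ⟨k, hk, h2⟩
    · rintro ⟨k, h1, h2⟩
      exact ⟨hTS k h1, h2⟩
  rw [hU, Set.ncard_iUnion_of_finite]
  · rw [finsum_eq_sum_of_fintype]
    push_cast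
    rfl
  · exact fun k => (hfin n).subset fun x hx => ⟨hTS k hx.1, hx.2⟩
  · intro k l hkl
    refine Set.disjoint_left.2 fun x hx hx' => hkl ?_
    exact (hex x (hTS k hx.1)).unique hx.1 hx'.1

end GradedSeries

/-! ### Half-open simplicial cones and their boxes -/

/-- `t + ε * s` is positive for all small positive `ε`. -/
def LexPos (t s : ℝ) : Prop := 0 < t ∨ t = 0 ∧ 0 < s

theorem LexPos.nonneg {t s : ℝ} (h : LexPos t s) : 0 ≤ t := by
  rcases h with h | ⟨h, -⟩
  · exact h.le
  · exact h.ge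

theorem LexPos.add_one {t s : ℝ} (h : LexPos t s) : LexPos (t + 1) s :=
  Or.inl (by linarith [h.nonneg])

theorem eventually_pos_iff_lexPos (t : ℝ) {s : ℝ} (hs : s ≠ 0) :
    ∀ᶠ ε in nhdsWithin (0 : ℝ) (Set.Ioi 0), t + ε * s ≠ 0 ∧ (0 < t + ε * s ↔ LexPos t s) := by
  have hlim : Filter.Tendsto (fun ε : ℝ => t + ε * s) (nhdsWithin 0 (Set.Ioi 0)) (nhds t) := by
    have : Filter.Tendsto (fun ε : ℝ => t + ε * s) (nhds 0) (nhds (t + 0 * s)) :=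
      Continuous.tendsto (by fun_prop) 0
    simpa using this.mono_left nhdsWithin_le_nhds
  rcases lt_trichotomy t 0 with ht | rfl | ht
  · filter_upwards [hlim.eventually (gt_mem_nhds ht)] with ε hε
    refine ⟨hε.ne, iff_of_false hε.not_gt fun h => ht.not_ge h.nonneg⟩
  · filter_upwards [self_mem_nhdsWithin] with ε hε
    have hε' : (0 : ℝ) < ε := hε
    simp [LexPos, hε', hε'.ne', hs]
  · filter_upwards [hlim.eventually (lt_mem_nhds ht)] with ε hε
    exact ⟨hε.ne', iff_of_true hε (Or.inl ht)⟩

variable {ι E : Type*} [Fintype ι] [AddCommGroup E] [Module ℝ E]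

namespace CoordSystem

variable {w : ι → E}

/-- The half-open simplicial cone of `b`, where a facet is removed if it is not visible in the
direction `ξ`. -/
def halfOpenCone (b : CoordSystem w) (ξ : E) : Set E :=
  {x | ∀ i ∈ b.support, LexPos (b.coord x i) (b.coord ξ i)}

theorem coord_nonneg_of_mem_halfOpenCone {b : CoordSystem w} {ξ x : E}
    (hx : x ∈ b.halfOpenCone ξ) (i : ι) : 0 ≤ b.coord x i := by
  by_cases hi : i ∈ b.support
  · exact (hx i hi).nonneg
  · exact (b.coord_eq_zero x i hi).ge

theorem halfOpenCone_subset (b : CoordSystem w) (ξ : E) : b.halfOpenCone ξ ⊆ coneOf w :=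
  fun x hx => ⟨b.coord x, coord_nonneg_of_mem_halfOpenCone hx, b.sum_coord x⟩

/-- The half-open simplicial cones of a regular triangulation partition the cone. -/
theorem existsUnique_mem_halfOpenCone {h : E →ₗ[ℝ] ℝ} {p : ℝ} (hp : 0 < p)
    (hh : ∀ i, h (w i) = p) (hw : Submodule.span ℝ (Set.range w) = ⊤) {ω : ι → ℝ}
    (hω : ∀ b : CoordSystem w, ∀ i ∉ b.support, b.price ω (w i) ≠ ω i)
    {ξ : E} (hξ : ξ ∈ coneOf w)
    (hξg : ∀ b : CoordSystem w, ∀ i ∈ b.support, b.coord ξ i ≠ 0)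
    {x : E} (hx : x ∈ coneOf w) :
    ∃! b : {b : CoordSystem w // b.IsDualFeasible ω}, x ∈ b.1.halfOpenCone ξ := by
  -- There are finitely many bases and coordinates, so one `ε` serves all. Then `x + ε • ξ` is
  -- generic, and its open cell is the half-open cell of `x`.
  have hev : ∀ᶠ ε in nhdsWithin (0 : ℝ) (Set.Ioi 0), ∀ b : CoordSystem w, ∀ i ∈ b.support,
      b.coord (x + ε • ξ) i ≠ 0 ∧
        (0 < b.coord (x + ε • ξ) i ↔ LexPos (b.coord x i) (b.coord ξ i)) := by
    refine Filter.eventually_all.2 fun b => ?_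
    rw [Filter.eventually_all_finset]
    intro i hi
    simpa using eventually_pos_iff_lexPos (b.coord x i) (hξg b i hi)
  obtain ⟨ε, hε, hpos⟩ := (hev.and self_mem_nhdsWithin).exists
  have hpos : (0 : ℝ) < ε := hpos
  have hcone : x + ε • ξ ∈ coneOf w := by
    obtain ⟨a, ha, rfl⟩ := hx
    obtain ⟨g, hg, rfl⟩ := hξ
    refine ⟨fun i => a i + ε * g i, fun i => add_nonneg (ha i) (mul_nonneg hpos.le (hg i)), ?_⟩
    simp [add_smul, mul_smul, Finset.sum_add_distrib, Finset.smul_sum]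
  obtain ⟨b, hb, hby⟩ := exists_isDualFeasible hp hh hw hω hcone fun b i hi => (hε b i hi).1
  refine ⟨⟨b, hb⟩, fun i hi => (hε b i hi).2.1 (hby i hi), ?_⟩
  rintro ⟨b', hb'⟩ hxb'
  exact Subtype.ext (eq_of_isDualFeasible hb' hb
    (fun i hi => (hε b' i hi).2.2 (hxb' i hi)) hby)

/-- The lattice points of a half-open cone that leave it when one of the generators indexed by
`J` is subtracted. -/
def partialBox (b : CoordSystem w) (ξ : E) (L : AddSubgroup E) (J : Finset ι) : Set E :=
  {x | x ∈ L ∧ x ∈ b.halfOpenCone ξ ∧ ∀ j ∈ J, ¬ LexPos (b.coord x j - 1) (b.coord ξ j)}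

/-- Subtracting `w i` lowers the `i`-th coordinate by one and changes no other, so each factor adds
exactly the box condition for its own index. -/
theorem gradedSeries_partialBox (b : CoordSystem w) (ξ : E) {L : AddSubgroup E}
    {h : E →ₗ[ℝ] ℝ} {p : ℕ} (hh : ∀ i, h (w i) = p) (hL : ∀ i, w i ∈ L)
    (hfin : ∀ n : ℕ, {x | (x ∈ L ∧ x ∈ coneOf w) ∧ h x = n}.Finite)
    {J : Finset ι} (hJ : J ⊆ b.support) :
    gradedSeries h {x | x ∈ L ∧ x ∈ b.halfOpenCone ξ} * (1 - PowerSeries.X ^ p) ^ #J =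
      gradedSeries h (b.partialBox ξ L J) := by
  classical
  induction J using Finset.induction_on with
  | empty => simp [partialBox]
  | insert i J hiJ ih =>
    have hi : i ∈ b.support := hJ (Finset.mem_insert_self i J)
    rw [Finset.card_insert_of_notMem hiJ, pow_succ, ← mul_assoc,
      ih ((Finset.subset_insert i J).trans hJ)]
    rw [gradedSeries_mul_one_sub_X_pow (v := w i) (hh i)]
    · congr 1
      ext x
      simp only [partialBox, Set.mem_ofPred_eq, Finset.forall_mem_insert, halfOpenCone, map_sub,
        Pi.sub_apply, b.coord_apply_self hi]
      constructor
      · rintro ⟨⟨h1, h2, h3⟩, h4⟩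
        refine ⟨h1, h2, fun hlex => h4 ⟨L.sub_mem h1 (hL i), fun j hj => ?_, fun j hj => ?_⟩, h3⟩
        · by_cases hji : j = i
          · subst hji; simpa using hlex
          · simpa [hji] using h2 j hj
        · have hji : j ≠ i := fun e => hiJ (e ▸ hj)
          simpa [hji] using h3 j hj
      · rintro ⟨h1, h2, h3, h4⟩
        exact ⟨⟨h1, h2, h4⟩, fun h5 => h3 (by simpa using h5.2.1 i hi)⟩
    · rintro x ⟨h1, h2, h3⟩
      refine ⟨L.add_mem h1 (hL i), fun j hj => ?_, fun j hj => ?_⟩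
      · rw [map_add, b.coord_apply_self hi]
        by_cases hji : j = i
        · subst hji; simpa using (h2 j hj).add_one
        · simpa [hji] using h2 j hj
      · have hji : j ≠ i := fun e => hiJ (e ▸ hj)
        simpa [b.coord_apply_self hi, hji] using h3 j hj
    · rintro x ⟨-, h2, -⟩
      obtain ⟨a, ha, rfl⟩ := b.halfOpenCone_subset ξ h2
      simp only [map_sum, map_smul, hh, smul_eq_mul]
      exact Finset.sum_nonneg fun i _ => mul_nonneg (ha i) (Nat.cast_nonneg p)
    · exact fun n => (hfin n).subset fun x hx => ⟨⟨hx.1.1, b.halfOpenCone_subset ξ hx.1.2.1⟩, hx.2⟩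

/-- Box coordinates are at most `1`. Positivity of `h ξ` gives `ξ` a positive coordinate, where the
value `1` is excluded; hence the strict inequality. -/
theorem height_lt_of_mem_partialBox {b : CoordSystem w} {ξ : E} {L : AddSubgroup E}
    {h : E →ₗ[ℝ] ℝ} {p : ℝ} (hp : 0 < p) (hh : ∀ i, h (w i) = p) (hξ : 0 < h ξ) {x : E}
    (hx : x ∈ b.partialBox ξ L b.support) : h x < p * Module.finrank ℝ E := by
  have hsum : ∀ y, h y = p * ∑ i ∈ b.support, b.coord y i := by
    intro y
    conv_lhs => rw [← b.sum_coord y]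
    simp only [map_sum, map_smul, hh, smul_eq_mul, ← Finset.sum_mul]
    rw [mul_comm, ← Finset.sum_subset (Finset.subset_univ b.support)
      fun i _ hi => b.coord_eq_zero y i hi]
  have hle : ∀ i ∈ b.support, b.coord x i ≤ 1 := by
    intro i hi
    by_contra hlt
    exact hx.2.2 i hi (Or.inl (by linarith))
  obtain ⟨i, hi, hξi⟩ : ∃ i ∈ b.support, 0 < b.coord ξ i := by
    by_contra! hneg
    have := Finset.sum_nonpos hneg
    rw [hsum] at hξ
    nlinarith
  have hlt : b.coord x i < 1 := by
    refine lt_of_le_of_ne (hle i hi) fun heq => hx.2.2 i hi (Or.inr ⟨by linarith, hξi⟩)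
  rw [hsum, ← b.card_support]
  refine mul_lt_mul_of_pos_left ?_ hp
  calc ∑ i ∈ b.support, b.coord x i < ∑ i ∈ b.support, (1 : ℝ) :=
        Finset.sum_lt_sum hle ⟨i, hi, hlt⟩
    _ = #b.support := by simp

end CoordSystem

/-- The Hilbert series of the lattice points of a cone with generators in the lattice at a fixed
height `p` has a nonnegative numerator of degree less than `p` times the dimension. -/
theorem exists_nonneg_numerator_of_cone [Nonempty ι] {w : ι → E} {L : AddSubgroup E}
    {h : E →ₗ[ℝ] ℝ} {p : ℕ} (hp : 0 < p) (hh : ∀ i, h (w i) = p) (hL : ∀ i, w i ∈ L)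
    (hw : Submodule.span ℝ (Set.range w) = ⊤)
    (hfin : ∀ n : ℕ, {x | (x ∈ L ∧ x ∈ coneOf w) ∧ h x = n}.Finite) :
    ∃ c : ℕ → ℕ, (∀ n, p * Module.finrank ℝ E ≤ n → c n = 0) ∧
      gradedSeries h {x | x ∈ L ∧ x ∈ coneOf w} *
        (1 - PowerSeries.X ^ p) ^ Module.finrank ℝ E = PowerSeries.mk fun n => (c n : ℤ) := by
  classical
  have hp' : (0 : ℝ) < p := by exact_mod_cast hp
  -- For `v` outside the support, this form in `ω` is the price of `w v` minus `ω v`; its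
  -- coefficient at `v` is `-1`.
  obtain ⟨ω, -, hω⟩ := exists_pos_forall_sum_mul_ne_zero
    (κ := {q : CoordSystem w × ι // q.2 ∉ q.1.support})
    (fun q => q.1.1.coord (w q.1.2) - Pi.single q.1.2 1) (by
      rintro ⟨⟨b, v⟩, hv⟩ h0
      have := congrFun h0 v
      simp only [Pi.sub_apply, b.coord_eq_zero _ v hv] at this
      simp at this)
  -- The form gives the `i`-th coordinate of `∑ j, g j • w j`; its coefficient at `i` is `1`.
  obtain ⟨g, hg, hgne⟩ := exists_pos_forall_sum_mul_ne_zero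
    (κ := {q : CoordSystem w × ι // q.2 ∈ q.1.support})
    (fun q j => q.1.1.coord (w j) q.1.2) (by
      rintro ⟨⟨b, i⟩, hi⟩ h0
      have := congrFun h0 i
      simp [b.coord_apply_self hi] at this)
  have hω' : ∀ b : CoordSystem w, ∀ i ∉ b.support, b.price ω (w i) ≠ ω i := by
    intro b i hi heq
    refine hω ⟨(b, i), hi⟩ ?_
    simp only [Pi.sub_apply, mul_sub, Finset.sum_sub_distrib, Pi.single_apply]
    simp only [mul_ite, mul_one, mul_zero, Finset.sum_ite_eq', Finset.mem_univ, if_true]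
    rw [← heq, CoordSystem.price, sub_eq_zero]
    exact Finset.sum_congr rfl fun j _ => mul_comm _ _
  set ξ : E := ∑ j, g j • w j with hξdef
  have hξ : ξ ∈ coneOf w := ⟨g, fun i => (hg i).le, rfl⟩
  have hξg : ∀ b : CoordSystem w, ∀ i ∈ b.support, b.coord ξ i ≠ 0 := by
    intro b i hi
    simpa [hξdef, map_sum, Finset.sum_apply] using hgne ⟨(b, i), hi⟩
  have hξh : 0 < h ξ := by
    simp only [hξdef, map_sum, map_smul, hh, smul_eq_mul]
    exact Finset.sum_pos (fun i _ => mul_pos (hg i) hp') Finset.univ_nonempty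
  let κ := {b : CoordSystem w // b.IsDualFeasible ω}
  have : Fintype κ := Fintype.ofFinite κ
  have hsum : gradedSeries h {x | x ∈ L ∧ x ∈ coneOf w} =
      ∑ b : κ, gradedSeries h {x | x ∈ L ∧ x ∈ b.1.halfOpenCone ξ} := by
    refine gradedSeries_eq_sum _ (fun b x hx => ⟨hx.1, b.1.halfOpenCone_subset ξ hx.2⟩) ?_ hfin
    rintro x ⟨hxL, hx⟩
    obtain ⟨b, hb, huniq⟩ := CoordSystem.existsUnique_mem_halfOpenCone hp' hh hw hω' hξ hξg hx
    exact ⟨b, ⟨hxL, hb⟩, fun b' hb' => huniq b' hb'.2⟩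
  refine ⟨fun n => ∑ b : κ, {x ∈ b.1.partialBox ξ L b.1.support | h x = n}.ncard, ?_, ?_⟩
  · intro n hn
    refine Finset.sum_eq_zero fun b _ => ?_
    suffices h0 : {x ∈ b.1.partialBox ξ L b.1.support | h x = n} = ∅ by rw [h0, Set.ncard_empty]
    refine Set.eq_empty_of_forall_notMem ?_
    rintro x ⟨hx, hxn⟩
    have := CoordSystem.height_lt_of_mem_partialBox hp' hh hξh hx
    rw [hxn] at this
    exact hn.not_gt (by exact_mod_cast this)
  · rw [hsum, Finset.sum_mul]
    have : ∀ b : κ, gradedSeries h {x | x ∈ L ∧ x ∈ b.1.halfOpenCone ξ} *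
        (1 - PowerSeries.X ^ p) ^ Module.finrank ℝ E =
          gradedSeries h (b.1.partialBox ξ L b.1.support) := by
      intro b
      rw [← b.1.card_support, b.1.gradedSeries_partialBox ξ hh hL hfin subset_rfl]
    rw [Finset.sum_congr rfl fun b _ => this b]
    ext n
    simp [gradedSeries, map_sum]

end Ehrhart

/-! ### The cone over a rational polytope -/

namespace Ehrhart

theorem IsRationalPolytope.convex {N : ℕ} {P : Set (Fin N → ℝ)} (hP : IsRationalPolytope P) :
    Convex ℝ P := by
  obtain ⟨⟨m, a, b, rfl⟩, -⟩ := hP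
  refine convex_iInter fun k => convex_halfSpace_le ⟨fun x y => ?_, fun c x => ?_⟩ _
  · simp [mul_add, Finset.sum_add_distrib]
  · simp [Finset.mul_sum, mul_left_comm]

theorem IsRationalPolytope.isCompact {N : ℕ} {P : Set (Fin N → ℝ)} (hP : IsRationalPolytope P) :
    IsCompact P := by
  obtain ⟨⟨m, a, b, rfl⟩, hb⟩ := hP
  refine Metric.isCompact_of_isClosed_isBounded (isClosed_iInter fun k => ?_) hb
  exact isClosed_le (by fun_prop) continuous_const

theorem finite_inter_integerPoints {N : ℕ} {S : Set (Fin N → ℝ)} (hS : Bornology.IsBounded S) :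
    (S ∩ integerPoints N).Finite := by
  obtain ⟨R, hR⟩ := hS.subset_closedBall 0
  refine ((Set.finite_Icc (fun _ : Fin N => -⌈R⌉) (fun _ => ⌈R⌉)).image
    fun (z : Fin N → ℤ) (j : Fin N) => (z j : ℝ)).subset ?_
  rintro _ ⟨hx, z, rfl⟩
  refine ⟨z, ?_, rfl⟩
  have h1 := hR hx
  have hR0 : 0 ≤ R := by
    have := mem_closedBall_zero_iff.1 h1
    exact (norm_nonneg _).trans this
  rw [mem_closedBall_zero_iff, pi_norm_le_iff_of_nonneg hR0] at h1
  have h2 : ∀ j, |(z j : ℝ)| ≤ R := fun j => h1 j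
  have h3 : ∀ j, |z j| ≤ ⌈R⌉ := fun j => by
    have : ((|z j| : ℤ) : ℝ) ≤ ⌈R⌉ := by
      rw [Int.cast_abs]; exact (h2 j).trans (Int.le_ceil R)
    exact_mod_cast this
  exact ⟨fun j => (abs_le.1 (h3 j)).1, fun j => (abs_le.1 (h3 j)).2⟩

/-- The span is the direction space at height zero plus one line that leaves height zero because `p
≠ 0`. -/
theorem finrank_span_lift {V : Type*} [AddCommGroup V] [Module ℝ V] [FiniteDimensional ℝ V]
    {A : Set V} (hA : A.Nonempty) {p : ℝ} (hp : p ≠ 0) :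
    Module.finrank ℝ (Submodule.span ℝ ((fun x : V => (x, p)) '' A)) =
      Module.finrank ℝ (vectorSpan ℝ A) + 1 := by
  obtain ⟨x₀, hx₀⟩ := hA
  set U := (vectorSpan ℝ A).map (LinearMap.inl ℝ V ℝ)
  have hsup : Submodule.span ℝ ((fun x : V => (x, p)) '' A) = U ⊔ ℝ ∙ (x₀, p) := by
    refine le_antisymm (Submodule.span_le.2 ?_) (sup_le ?_ ?_)
    · rintro _ ⟨x, hx, rfl⟩
      have : (x, p) = ((x - x₀, 0) : V × ℝ) + (x₀, p) := by simp
      simp only [SetLike.mem_coe, this]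
      exact Submodule.add_mem_sup
        (Submodule.mem_map.2 ⟨x - x₀, vsub_mem_vectorSpan ℝ hx hx₀, rfl⟩)
        (Submodule.mem_span_singleton_self _)
    · rw [Submodule.map_le_iff_le_comap, vectorSpan_def, Submodule.span_le]
      rintro _ ⟨x, hx, y, hy, rfl⟩
      have : ((x - y, 0) : V × ℝ) = (x, p) - (y, p) := by simp
      simp only [Submodule.comap_coe, Set.mem_preimage, LinearMap.inl_apply, vsub_eq_sub,
        SetLike.mem_coe, this]
      exact Submodule.sub_mem _ (Submodule.subset_span ⟨x, hx, rfl⟩)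
        (Submodule.subset_span ⟨y, hy, rfl⟩)
    · rw [Submodule.span_singleton_le_iff_mem]
      exact Submodule.subset_span ⟨x₀, hx₀, rfl⟩
  have hinf : U ⊓ ℝ ∙ (x₀, p) = ⊥ := by
    rw [eq_bot_iff]
    rintro _ ⟨⟨u, -, rfl⟩, hx⟩
    obtain ⟨c, hc⟩ := Submodule.mem_span_singleton.1 hx
    simp only [Prod.smul_mk, LinearMap.inl_apply, Prod.mk.injEq, smul_eq_mul, mul_eq_zero, hp,
      or_false] at hc
    obtain ⟨h1, rfl⟩ := hc
    simp [← h1]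
  have h1 := Submodule.finrank_sup_add_finrank_inf_eq U (ℝ ∙ (x₀, p))
  have h2 : Module.finrank ℝ U = Module.finrank ℝ (vectorSpan ℝ A) :=
    (Submodule.equivMapOfInjective _ LinearMap.inl_injective _).finrank_eq.symm
  have h3 : Module.finrank ℝ (ℝ ∙ ((x₀, p) : V × ℝ)) = 1 :=
    finrank_span_singleton (by simp [hp])
  rw [hinf, finrank_bot, h2, h3] at h1
  rw [hsup, ← h1, add_zero]

/-- The right side describes the slice at height `n` of the cone over `W` placed at height `p`;
convex weights are rescaled by `n / p`. -/
theorem mem_smul_iff_exists_nonneg {V : Type*} [AddCommGroup V] [Module ℝ V] {P W : Set V}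
    [Fintype W] (hW : W.Nonempty) {p : ℝ} (hp : 0 < p) (hPW : p • P = convexHull ℝ W) {n : ℝ}
    (hn : 0 ≤ n) {z : V} :
    z ∈ n • P ↔ ∃ a : W → ℝ, (∀ i, 0 ≤ a i) ∧ ∑ i, a i * p = n ∧ ∑ i, a i • (i : V) = z := by
  have hull : ∀ x, x ∈ P ↔ ∃ b : W → ℝ, (∀ i, 0 ≤ b i) ∧ ∑ i, b i = 1 ∧
      ∑ i, b i • (i : V) = p • x := by
    intro x
    rw [← Set.smul_mem_smul_set_iff₀ hp.ne', hPW, W.toFinite.convexHull_eq_image]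
    simp only [stdSimplex, Set.mem_image, Set.mem_ofPred_eq, and_assoc, LinearMap.coe_sum,
      Finset.sum_apply, LinearMap.smulRight_apply, LinearMap.proj_apply]
    congr!
  constructor
  · rintro ⟨y, hy, rfl⟩
    obtain ⟨b, hb, hb1, hby⟩ := (hull y).1 hy
    refine ⟨fun i => n / p * b i, fun i => mul_nonneg (div_nonneg hn hp.le) (hb i), ?_, ?_⟩
    · rw [← Finset.sum_mul, ← Finset.mul_sum, hb1]
      field_simp
    · simp only [mul_smul, ← Finset.smul_sum, hby]
      rw [smul_smul, div_mul_cancel₀ _ hp.ne']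
  · rintro ⟨a, ha, han, rfl⟩
    rcases hn.eq_or_lt with rfl | hn
    · have ha0 : ∀ i, a i = 0 := fun i => by
        have := (Finset.sum_eq_zero_iff_of_nonneg fun i _ => mul_nonneg (ha i) hp.le).1 han i
          (Finset.mem_univ i)
        simpa [hp.ne'] using this
      have hPne : P.Nonempty := by
        rw [← Set.smul_set_nonempty (a := p), hPW]
        exact hW.convexHull
      simp [ha0, Set.zero_smul_set hPne]
    · refine ⟨n⁻¹ • ∑ i, a i • (i : V), (hull _).2 ⟨fun i => p * n⁻¹ * a i, fun i => ?_, ?_, ?_⟩,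
        by simp [smul_smul, hn.ne']⟩
      · have := ha i; positivity
      · rw [← Finset.mul_sum, mul_right_comm, mul_comm p, Finset.sum_mul, han,
          mul_inv_cancel₀ hn.ne']
      · simp only [mul_smul, ← Finset.smul_sum]

/-- The Ehrhart series of a rational polytope `P` such that `p P` is integral has a numerator of
degree less than `(d + 1) p` with nonnegative coefficients. -/
theorem exists_nonneg_numerator {N d p : ℕ} (hp : 0 < p) {P : Set (Fin N → ℝ)}
    (hP : IsRationalPolytope P) (hne : P.Nonempty) (hdim : polytopeDim P = d)
    (hint : HasIntegralVertices ((p : ℝ) • P)) :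
    ∃ c : ℕ → ℕ, (∀ n, (d + 1) * p ≤ n → c n = 0) ∧
      ehrhartSeries P * (1 - PowerSeries.X ^ p) ^ (d + 1) =
        PowerSeries.mk fun n => (c n : ℤ) := by
  classical
  have hp' : (0 : ℝ) < p := by exact_mod_cast hp
  set W := Set.extremePoints ℝ ((p : ℝ) • P)
  have hcomp : IsCompact ((p : ℝ) • P) := hP.isCompact.smul _
  -- The vertices are integral points of a bounded set, hence finite in number; so Krein–Milman
  -- needs no closure.
  have hWfin : W.Finite := (finite_inter_integerPoints hcomp.isBounded).subset fun x hx =>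
    ⟨hx.1, hint hx⟩
  have hPW : (p : ℝ) • P = convexHull ℝ W := by
    rw [← closure_convexHull_extremePoints hcomp (hP.convex.smul _)]
    exact (hWfin.isClosed_convexHull ℝ).closure_eq
  have hWne : W.Nonempty := hcomp.extremePoints_nonempty hne.smul_set
  have : Fintype W := hWfin.fintype
  have : Nonempty W := hWne.to_subtype
  let S := Submodule.span ℝ ((fun x : Fin N → ℝ => (x, (p : ℝ))) '' W)
  let w : W → S := fun i => ⟨(i, p), Submodule.subset_span ⟨i, i.2, rfl⟩⟩
  let h : S →ₗ[ℝ] ℝ := LinearMap.snd ℝ (Fin N → ℝ) ℝ ∘ₗ S.subtype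
  let emb : (Fin N → ℤ) →+ (Fin N → ℝ) :=
    { toFun := fun z j => (z j : ℝ)
      map_zero' := by ext; simp
      map_add' := fun x y => by ext; simp }
  -- Only the first component must be integral; the height is left free, since `gradedSeries` sees
  -- natural heights only.
  let L : AddSubgroup S := emb.range.comap
    (LinearMap.fst ℝ (Fin N → ℝ) ℝ ∘ₗ S.subtype).toAddMonoidHom
  have hLmem : ∀ x : S, x ∈ L ↔ x.1.1 ∈ integerPoints N := fun x => Iff.rfl
  have hw : Submodule.span ℝ (Set.range w) = ⊤ := by
    refine Submodule.map_injective_of_injective S.injective_subtype ?_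
    rw [Submodule.map_span, Submodule.map_top, Submodule.range_subtype, ← Set.range_comp]
    congr 1
    ext x
    simp [w]
  have hrank : Module.finrank ℝ S = d + 1 := by
    rw [finrank_span_lift hWne hp'.ne', ← direction_affineSpan, ← affineSpan_convexHull, ← hPW,
      direction_affineSpan, ← hdim, polytopeDim, direction_affineSpan]
    congr 1
    let e := LinearEquiv.smulOfNeZero ℝ (Fin N → ℝ) (p : ℝ) hp'.ne'
    have : vectorSpan ℝ ((p : ℝ) • P) = (vectorSpan ℝ P).map (e : (Fin N → ℝ) →ₗ[ℝ] _) := by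
      have := AffineMap.map_vectorSpan
        (f := (e : (Fin N → ℝ) →ₗ[ℝ] (Fin N → ℝ)).toAffineMap) (s := P)
      exact this.symm
    rw [this]
    exact e.finrank_map_eq _
  have himg : ∀ n : ℕ, (fun x : S => x.1.1) '' {x | (x ∈ L ∧ x ∈ coneOf w) ∧ h x = n} =
      ((n : ℝ) • P) ∩ integerPoints N := by
    intro n
    ext z
    rw [Set.mem_inter_iff, mem_smul_iff_exists_nonneg hWne hp' hPW (Nat.cast_nonneg n)]
    constructor
    · rintro ⟨x, ⟨⟨hxL, a, ha, rfl⟩, hx⟩, rfl⟩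
      refine ⟨⟨a, ha, ?_, ?_⟩, hxL⟩
      · simpa [h, w, Prod.snd_sum] using hx
      · simp [w, Prod.fst_sum]
    · rintro ⟨⟨a, ha, han, rfl⟩, hz⟩
      have h1 : (∑ i, a i • w i : S).1.1 = ∑ i, a i • (i : Fin N → ℝ) := by
        simp [w, Prod.fst_sum]
      refine ⟨∑ i, a i • w i, ⟨⟨(hLmem _).2 (h1 ▸ hz), a, ha, rfl⟩, ?_⟩, h1⟩
      simpa [h, w, Prod.snd_sum] using han
  have hinj : ∀ n : ℕ, Set.InjOn (fun x : S => x.1.1)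
      {x | (x ∈ L ∧ x ∈ coneOf w) ∧ h x = n} := by
    rintro n x ⟨-, hx⟩ y ⟨-, hy⟩ hxy
    exact Subtype.ext (Prod.ext hxy (hx.trans hy.symm))
  have hfin : ∀ n : ℕ, {x | (x ∈ L ∧ x ∈ coneOf w) ∧ h x = n}.Finite := fun n =>
    Set.Finite.of_finite_image (himg n ▸ finite_inter_integerPoints
      (hP.isCompact.smul (n : ℝ)).isBounded) (hinj n)
  have hseries : ehrhartSeries P = gradedSeries h {x | x ∈ L ∧ x ∈ coneOf w} := by
    ext n
    simp only [ehrhartSeries, gradedSeries, PowerSeries.coeff_mk]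
    have hcount : latticeCount P n = {x | (x ∈ L ∧ x ∈ coneOf w) ∧ h x = n}.ncard := by
      rw [latticeCount, ← himg, (hinj n).ncard_image]
    split_ifs with hn
    -- The constant term `1`, set by convention, agrees with the count because `0 • P = {0}` for
    -- nonempty `P`.
    · have hone : latticeCount P n = 1 := by
        have h0 : (0 : Fin N → ℝ) ∈ integerPoints N := ⟨0, by ext; simp⟩
        rw [latticeCount, hn, Nat.cast_zero, Set.zero_smul_set hne,
          Set.inter_eq_left.2 (by simpa using h0)]
        exact Set.ncard_singleton 0
      rw [← Nat.cast_one, ← hone, hcount]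
      rfl
    · rw [hcount]
      rfl
  obtain ⟨c, hc, hmul⟩ := exists_nonneg_numerator_of_cone (w := w) (L := L) (h := h) hp
    (fun i => rfl) (fun i => (hLmem _).2 (hint i.2)) hw hfin
  rw [hrank] at hc hmul
  exact ⟨c, fun n hn => hc n (by rwa [mul_comm]), hseries ▸ hmul⟩

end Ehrhart

/-! ### Comparison of coefficients -/

theorem theorem2 (N d p : ℕ) (hp : 0 < p) (P : Set (Fin N → ℝ))
    (hP : Ehrhart.IsRationalPolytope P) (hne : P.Nonempty)
    (hdim : Ehrhart.polytopeDim P = d)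
    (hint : Ehrhart.HasIntegralVertices ((p : ℝ) • P)) :
    (∃ a : Fin ((d + 1) * p) → ℤ, Ehrhart.IsEhrhartNumerator P d p a) ∧
      ∀ a : Fin ((d + 1) * p) → ℤ, Ehrhart.IsEhrhartNumerator P d p a → ∀ i, 0 ≤ a i := by
  obtain ⟨c, hc, hmul⟩ := Ehrhart.exists_nonneg_numerator hp hP hne hdim hint
  have hcoeff : ∀ (a : Fin ((d + 1) * p) → ℤ) (n : ℕ),
      PowerSeries.coeff n (∑ i, PowerSeries.C (a i) * (PowerSeries.X : PowerSeries ℤ) ^ (i : ℕ)) =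
        if hn : n < (d + 1) * p then a ⟨n, hn⟩ else 0 := by
    intro a n
    simp only [map_sum, PowerSeries.coeff_C_mul, PowerSeries.coeff_X_pow, mul_ite, mul_one,
      mul_zero]
    split_ifs with hn
    · rw [Finset.sum_eq_single ⟨n, hn⟩]
      · simp
      · exact fun j _ hj => if_neg fun h : n = j => hj (Fin.ext h.symm)
      · simp
    · refine Finset.sum_eq_zero fun j _ => if_neg ?_
      rintro rfl
      exact hn j.2
  refine ⟨⟨fun i => c i, ?_⟩, fun a ha i => ?_⟩
  · rw [Ehrhart.IsEhrhartNumerator, hmul]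
    ext n
    rw [hcoeff, PowerSeries.coeff_mk]
    split_ifs with hn
    · rfl
    · exact_mod_cast hc n (not_lt.1 hn)
  -- The cleared identity determines every coefficient, so any numerator agrees with the counts `c`.
  · rw [Ehrhart.IsEhrhartNumerator, hmul] at ha
    have := congrArg (PowerSeries.coeff (i : ℕ)) ha
    rw [hcoeff, PowerSeries.coeff_mk, dif_pos i.2] at this
    exact this ▸ Int.natCast_nonneg _
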